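/- A project is a pair $(F,c)$, where $F$ is a probability law on $\mathbb{R}_+$ with finite mean (the law of its prize) and $c\ge 0$ is the cost of sampling it. A contract is a measurable $w:\mathbb{R}_+\to\mathbb{R}_+$. Given a contract $w$ and a finite family $\mathcal{A}=(a_i)_{i=0}^n$ of projects $a_i=(F_i,c_i)$ with independent prizes $y_i\sim F_i$, an agent searches sequentially with recall: a strategy is a measurable rule that, as a function of the set of projects sampled so far and the highest wage available so far, either selects an unsampled project to sample next or stops. The agent can always present the prize $0$; on stopping he presents, among $0$ and the sampled prizes, one with the highest wage, choosing the largest such prize in case of a tie. If the presented prize is $y$, the agent's payoff is $w(y)$ minus the costs of the sampled projects, and the principal's payoff is $y-w(y)$. Let $\Sigma(w,\mathcal{A})$ be the set of strategies that maximize the agent's expected payoff, and let $V_P(w\mid\mathcal{A})=\sup_{\sigma\in\Sigma(w,\mathcal{A})}\mathbb{E}_\sigma[y-w(y)]$. Fix a known project $a_0=(F_0,c_0)$, and define the payoff guarantee $V_P(w)=\inf_{\mathcal{A}\ni a_0}V_P(w\mid\mathcal{A})$ and $V_P=\sup_w V_P(w)$, the supremum being over all contracts. A contract $w$ is robustly optimal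 if $V_P(w)=V_P$. Let $s_0=\mathbb{E}_{F_0}[y]-c_0$ be the full surplus of $a_0$, and let its Weitzman index $r_0$ be the smallest solution $r\in\mathbb{R}\cup\{+\infty\}$ of $c_0=\int[y-r]^+\,dF_0(y)$ (where $r=+\infty$ counts as a solution if $c_0=0$, with $[y-\infty]^+=0$). Proposition 1. Suppose $r_0\ge 0$ (equivalently, $s_0\ge 0$). Then the $r_0$-debt contract $w_0(y)=[y-r_0]^+$ has payoff guarantee $V_P(w_0)=s_0$. Hence $w_0$ is robustly optimal, and $V_P=V_P(w_0)=s_0$. -/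

import Mathlib

open MeasureTheory Set
open scoped NNReal ENNReal

noncomputable section

namespace DelegatedSearch

/-- A project (Pandora's box): a law of the prize on `ℝ₊` with finite expectation, and the
exploration cost. -/
structure Project where
  law : ProbabilityMeasure ℝ≥0
  cost : ℝ≥0
  finite_mean : ∫⁻ y, (y : ℝ≥0∞) ∂(law : Measure ℝ≥0) ≠ ∞

/-- A wage contract: a measurable function of the presented prize with nonnegative values
(limited liability). -/
structure Contract where
  wage : ℝ≥0 → ℝ≥0
  measurable_wage : Measurable wage

/-- The positive part `[y - z]⁺`, for an extended real level `z`; it is `0` at `z = +∞`. -/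
def excess (y : ℝ≥0) (z : EReal) : ℝ≥0∞ := (((y : ℝ) : EReal) - z).toENNReal

theorem excess_coe (y : ℝ≥0) (z : ℝ) : excess y (z : EReal) = ENNReal.ofReal ((y : ℝ) - z) := by
  rw [excess, ← EReal.coe_sub, EReal.toENNReal_of_ne_top (EReal.coe_ne_top _), EReal.toReal_coe]

theorem excess_top (y : ℝ≥0) : excess y ⊤ = 0 := by
  simp [excess]

theorem measurable_excess (z : EReal) : Measurable fun y : ℝ≥0 => excess y z := by
  induction z with
  | bot => simp [excess]
  | top => simp [excess]
  | coe z =>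
    simp only [excess_coe]
    fun_prop

/-- The Weitzman index of a project: the smallest solution `r` of `c = ∫ [y - r]⁺ dF(y)`. The
value `+∞` counts as a solution when `c = 0`. -/
def Project.index (a : Project) : EReal :=
  sInf {r : EReal | (a.cost : ℝ≥0∞) = ∫⁻ y, excess y r ∂(a.law : Measure ℝ≥0)}

/-- The full surplus `E_F[y] - c` of a project. -/
def Project.surplus (a : Project) : ℝ :=
  ∫ y, (y : ℝ) ∂(a.law : Measure ℝ≥0) - (a.cost : ℝ)

/-- The `z`-debt contract `w(y) = [y - z]⁺`. -/
def debtContract (z : EReal) : Contract where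
  wage y := (excess y z).toNNReal
  measurable_wage := (measurable_excess z).ennreal_toNNReal

/-- A search strategy for `n + 1` projects. Given the set of projects sampled so far and the highest
wage obtainable so far, it names an unsampled project to sample next, or stops (`none`). -/
structure Strategy (n : ℕ) where
  next : Finset (Fin (n + 1)) → ℝ≥0 → Option (Fin (n + 1))
  next_notMem : ∀ S v i, next S v = some i → i ∉ S
  measurable_next : ∀ S o, MeasurableSet {v | next S v = o}

/-- Of the prizes `p` and `y`, the one with the higher wage; if the wages are equal, the larger
prize (the one that the principal prefers). -/
def Contract.better (w : Contract) (p y : ℝ≥0) : ℝ≥0 :=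
  if w.wage p < w.wage y ∨ (w.wage p = w.wage y ∧ p ≤ y) then y else p

/-- At most `k` further steps of the search when the prizes of the projects are `y`, from the state in
which the projects in `S` have been sampled and `p` is the best available prize for the agent. The
result is the set of sampled projects and the presented prize at the end. -/
def Strategy.run {n : ℕ} (σ : Strategy n) (w : Contract) (y : Fin (n + 1) → ℝ≥0) :
    ℕ → Finset (Fin (n + 1)) → ℝ≥0 → Finset (Fin (n + 1)) × ℝ≥0
  | 0, S, p => (S, p)
  | k + 1, S, p =>
    match σ.next S (w.wage p) with
    | none => (S, p)
    | some i => σ.run w y k (insert i S) (w.better p (y i))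

/-- The outcome of the whole search. It starts with no sampled project and with the prize zero,
which the agent can always present; with `n + 1` projects it lasts at most `n + 1` steps. -/
def Strategy.outcome {n : ℕ} (σ : Strategy n) (w : Contract) (y : Fin (n + 1) → ℝ≥0) :
    Finset (Fin (n + 1)) × ℝ≥0 :=
  σ.run w y (n + 1) ∅ 0

/-- The joint law of the independent prizes of the projects. -/
def prizeLaw {n : ℕ} (a : Fin (n + 1) → Project) : Measure (Fin (n + 1) → ℝ≥0) :=
  Measure.pi fun i => ((a i).law : Measure ℝ≥0)

/-- The agent's expected payoff: the expected wage, possibly `+∞`, minus the expected (finite) cost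
of the sampled projects. -/
def agentPayoff {n : ℕ} (w : Contract) (a : Fin (n + 1) → Project) (σ : Strategy n) : EReal :=
  ((∫⁻ y, (w.wage (σ.outcome w y).2 : ℝ≥0∞) ∂prizeLaw a : ℝ≥0∞) : EReal) -
    ((∫⁻ y, ∑ i ∈ (σ.outcome w y).1, ((a i).cost : ℝ≥0∞) ∂prizeLaw a : ℝ≥0∞) : EReal)

/-- The principal's expected payoff `E_σ[y - w(y)]`: the expected (finite) prize minus the expected
wage, possibly `+∞`. -/
def principalPayoff {n : ℕ} (w : Contract) (a : Fin (n + 1) → Project) (σ : Strategy n) : EReal :=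
  ((∫⁻ y, ((σ.outcome w y).2 : ℝ≥0∞) ∂prizeLaw a : ℝ≥0∞) : EReal) -
    ((∫⁻ y, (w.wage (σ.outcome w y).2 : ℝ≥0∞) ∂prizeLaw a : ℝ≥0∞) : EReal)

/-- The set `Σ(w, 𝒜)` of the agent's optimal search strategies. -/
def optimalStrategies {n : ℕ} (w : Contract) (a : Fin (n + 1) → Project) : Set (Strategy n) :=
  {σ | ∀ τ : Strategy n, agentPayoff w a τ ≤ agentPayoff w a σ}

/-- `V_P(w | 𝒜)`: the principal's payoff, ties being broken in her favour. -/
def principalValue {n : ℕ} (w : Contract) (a : Fin (n + 1) → Project) : EReal :=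
  ⨆ σ ∈ optimalStrategies w a, principalPayoff w a σ

/-- The payoff guarantee `V_P(w)`: the infimum of `V_P(w | 𝒜)` over the finite families `𝒜` of
projects that contain the known project. -/
def payoffGuarantee (a₀ : Project) (w : Contract) : EReal :=
  ⨅ (n : ℕ) (a : Fin (n + 1) → Project) (_ : a 0 = a₀), principalValue w a

/-- `V_P`: the supremum of the payoff guarantee over all contracts. -/
def maxGuarantee (a₀ : Project) : EReal := ⨆ w : Contract, payoffGuarantee a₀ w

/-- A contract is robustly optimal if its payoff guarantee is `V_P`. -/
def RobustlyOptimal (a₀ : Project) (w : Contract) : Prop :=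
  payoffGuarantee a₀ w = maxGuarantee a₀

end DelegatedSearch

end

noncomputable section

namespace DelegatedSearch

/-! ### The Weitzman index solves its equation -/

/-! Under the debt contract the principal's share of a prize is min(y, r₀), and r₀ is the debt level
at which the expected wage from `a₀` alone equals its cost
(`Project.cost_eq_lintegral_excess_index`). Hence this share has mean s₀ under F₀, and an agent who
holds a zero wage never loses by sampling `a₀`. An optimal strategy that samples when indifferent
therefore ends either with a positive wage, where the share takes its maximal value r₀, or with `a₀`
sampled (`greedyStrategy_run_pos`). The share is monotone along the agent's ranking of prizes, so in
both cases it is at least min(y₀, r₀), path by path and whatever the other projects are. Integration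
gives `surplus_le_principalValue`. That the strategy is optimal is backward induction
(`lintegral_wage_run_le`, `lintegral_wage_greedyStrategy`).

Conversely, if `a₀` is the only project, the total surplus is at most s₀, and the agent gets at
least 0 because he may stop at once; so no contract guarantees more than s₀
(`principalValue_singleton_le`). -/

theorem continuous_excess (y : ℝ≥0) : Continuous (excess y) := by
  refine EReal.continuous_toENNReal.comp (continuous_iff_continuousAt.2 fun z => ?_)
  change ContinuousAt (fun z : EReal => ((y : ℝ) : EReal) + -z) z
  exact (EReal.continuousAt_add (p := (((y : ℝ) : EReal), -z)) (by simp) (by simp)).comp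
    (f := fun z : EReal => (((y : ℝ) : EReal), -z)) (by fun_prop)

theorem antitone_excess (y : ℝ≥0) : Antitone (excess y) := fun _ _ h =>
  EReal.toENNReal_le_toENNReal (EReal.sub_le_sub le_rfl h)

theorem excess_zero (y : ℝ≥0) : excess y 0 = y := by
  rw [← EReal.coe_zero, excess_coe, sub_zero, ENNReal.ofReal_coe_nnreal]

theorem excess_bot (y : ℝ≥0) : excess y ⊥ = ⊤ := by
  rw [excess, EReal.sub_bot (by simp), EReal.toENNReal_top]

theorem excess_le {z : EReal} (hz : 0 ≤ z) (y : ℝ≥0) : excess y z ≤ y :=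
  (antitone_excess y hz).trans_eq (excess_zero y)

theorem lintegral_excess_coe_ne_top (a : Project) (z : ℝ) :
    ∫⁻ y, excess y z ∂(a.law : Measure ℝ≥0) ≠ ⊤ := by
  have h : ∀ y : ℝ≥0, excess y z ≤ y + ENNReal.ofReal |z| := fun y => by
    rw [excess_coe, ← ENNReal.ofReal_coe_nnreal, ← ENNReal.ofReal_add y.coe_nonneg (abs_nonneg z)]
    exact ENNReal.ofReal_le_ofReal (by linarith [neg_abs_le z])
  refine ne_top_of_le_ne_top ?_ (lintegral_mono h)
  rw [lintegral_add_right _ measurable_const]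
  simp [a.finite_mean]

/-- Dominated convergence away from `⊥`, with the excess over a smaller real level as the bound; at
`⊥` the integral is at least `excess 0 z`, which tends to `⊤`. -/
theorem continuous_lintegral_excess (a : Project) :
    Continuous fun z => ∫⁻ y, excess y z ∂(a.law : Measure ℝ≥0) := by
  refine continuous_iff_continuousAt.2 fun z => ?_
  rcases eq_or_ne z ⊥ with rfl | hz
  · have h : Filter.Tendsto (excess 0) (nhds ⊥) (nhds ⊤) := by
      simpa [excess_bot] using (continuous_excess 0).tendsto ⊥
    have hm : ∀ z, excess 0 z ≤ ∫⁻ y, excess y z ∂(a.law : Measure ℝ≥0) := fun z => by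
      calc excess 0 z = ∫⁻ _, excess 0 z ∂(a.law : Measure ℝ≥0) := by simp
        _ ≤ _ := lintegral_mono fun y => EReal.toENNReal_le_toENNReal
          (EReal.sub_le_sub (by exact_mod_cast y.2) le_rfl)
    simpa [ContinuousAt, excess_bot] using tendsto_nhds_top_mono' h hm
  · obtain ⟨x, hx⟩ := EReal.lt_iff_exists_real_btwn.1 (bot_lt_iff_ne_bot.2 hz)
    refine tendsto_lintegral_filter_of_dominated_convergence (fun y => excess y x)
      (.of_forall fun z => measurable_excess z) ?_ (lintegral_excess_coe_ne_top a x)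
      (.of_forall fun y => (continuous_excess y).tendsto z)
    filter_upwards [lt_mem_nhds hx.2] with u hu
    exact .of_forall fun y => antitone_excess y hu.le

/-- The solution set is closed by continuity and nonempty by the intermediate value theorem on
`EReal`, so it contains its infimum. -/
theorem Project.cost_eq_lintegral_excess_index (a : Project) :
    (a.cost : ℝ≥0∞) = ∫⁻ y, excess y a.index ∂(a.law : Measure ℝ≥0) := by
  have hc := continuous_lintegral_excess a
  have hne : {r : EReal | (a.cost : ℝ≥0∞) = ∫⁻ y, excess y r ∂(a.law : Measure ℝ≥0)}.Nonempty := by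
    obtain ⟨r, hr⟩ := mem_range_of_exists_le_of_exists_ge hc
      (⟨⊤, by simp [excess_top]⟩ : ∃ r, _ ≤ (a.cost : ℝ≥0∞))
      ⟨⊥, by simp [excess_bot]⟩
    exact ⟨r, hr.symm⟩
  exact (isClosed_eq continuous_const hc).sInf_mem hne

theorem Project.integral_prize (a : Project) :
    ENNReal.ofReal (∫ y, (y : ℝ) ∂(a.law : Measure ℝ≥0)) =
      ∫⁻ y, (y : ℝ≥0∞) ∂(a.law : Measure ℝ≥0) := by
  rw [integral_eq_lintegral_of_nonneg_ae (.of_forall fun y => y.2) (by fun_prop)]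
  simp only [ENNReal.ofReal_coe_nnreal]
  exact ENNReal.ofReal_toReal a.finite_mean

theorem Project.surplus_nonneg {a : Project} (h : 0 ≤ a.index) : 0 ≤ a.surplus := by
  have h1 : (a.cost : ℝ≥0∞) ≤ ENNReal.ofReal (∫ y, (y : ℝ) ∂(a.law : Measure ℝ≥0)) := by
    rw [a.integral_prize, a.cost_eq_lintegral_excess_index]
    exact lintegral_mono fun y => excess_le h y
  rw [← ENNReal.ofReal_coe_nnreal,
    ENNReal.ofReal_le_ofReal_iff (integral_nonneg fun y => y.2)] at h1
  exact sub_nonneg.2 h1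

theorem Project.lintegral_prize {a : Project} (h : 0 ≤ a.surplus) :
    ∫⁻ y, (y : ℝ≥0∞) ∂(a.law : Measure ℝ≥0) = ENNReal.ofReal a.surplus + a.cost := by
  rw [← a.integral_prize, ← ENNReal.ofReal_coe_nnreal, ← ENNReal.ofReal_add h a.cost.coe_nonneg]
  simp [Project.surplus]

/-! ### Debt contracts -/

theorem coe_wage_debtContract {z : EReal} (hz : 0 ≤ z) (y : ℝ≥0) :
    ((debtContract z).wage y : ℝ≥0∞) = excess y z :=
  ENNReal.coe_toNNReal (ne_top_of_le_ne_top ENNReal.coe_ne_top (excess_le hz y))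

theorem wage_debtContract_le {z : EReal} (hz : 0 ≤ z) (y : ℝ≥0) : (debtContract z).wage y ≤ y := by
  exact_mod_cast (coe_wage_debtContract hz y).trans_le (excess_le hz y)

/-- The principal's share of a prize under a debt contract grows with the agent's ranking. -/
theorem sub_wage_debtContract_le {z : EReal} (hz : 0 ≤ z) {x y : ℝ≥0}
    (h : 0 < (debtContract z).wage y ∨
      (debtContract z).wage x ≤ (debtContract z).wage y ∧
        ((debtContract z).wage x = (debtContract z).wage y → x ≤ y)) :
    x - (debtContract z).wage x ≤ y - (debtContract z).wage y := by
  -- If `y` earns nothing, neither does `x`, and the tie-break gives `x ≤ y`. Otherwise `y` exceeds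
  -- the debt and its share is `z`, the largest possible.
  rcases eq_or_ne ((debtContract z).wage y) 0 with h0 | h0
  · simp only [h0, lt_irrefl, false_or, nonpos_iff_eq_zero] at h
    simpa [h0, h.1] using h.2 h.1
  · induction z with
    | bot => simp at hz
    | top => simp [debtContract, excess_top] at h0
    | coe z =>
      have hw : ∀ y, (debtContract z).wage y = Real.toNNReal (y - z) := fun y => by
        simp [debtContract, excess_coe, ENNReal.ofReal]
      have hy : z < y := by simpa [hw] using h0
      rw [← NNReal.coe_le_coe, NNReal.coe_sub (wage_debtContract_le hz x),
        NNReal.coe_sub (wage_debtContract_le hz y), hw, hw, Real.coe_toNNReal', Real.coe_toNNReal',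
        max_eq_left (sub_nonneg.2 hy.le)]
      linarith [le_max_left ((x : ℝ) - z) 0]

/-! ### Running a strategy -/

theorem Contract.wage_better (w : Contract) (p y : ℝ≥0) :
    w.wage (w.better p y) = max (w.wage p) (w.wage y) := by
  unfold Contract.better
  split_ifs with h
  · rcases h with h | h
    · exact (max_eq_right h.le).symm
    · exact (max_eq_right h.1.le).symm
  · push Not at h
    exact (max_eq_left h.1).symm

theorem Contract.measurable_better (w : Contract) (p : ℝ≥0) : Measurable (w.better p) := by
  have := w.measurable_wage
  refine Measurable.ite ?_ measurable_id measurable_const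
  exact (measurableSet_lt measurable_const this).union
    ((measurableSet_eq_fun measurable_const this).inter measurableSet_Ici)

theorem Contract.measurable_better_uncurry (w : Contract) :
    Measurable fun x : ℝ≥0 × ℝ≥0 => w.better x.1 x.2 := by
  have hw := w.measurable_wage
  have h1 : Measurable fun x : ℝ≥0 × ℝ≥0 => w.wage x.1 := by fun_prop
  have h2 : Measurable fun x : ℝ≥0 × ℝ≥0 => w.wage x.2 := by fun_prop
  refine Measurable.ite ?_ measurable_snd measurable_fst
  exact (measurableSet_lt h1 h2).union
    ((measurableSet_eq_fun h1 h2).inter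
      (measurableSet_le (f := fun x : ℝ≥0 × ℝ≥0 => x.1) (g := fun x => x.2) (by fun_prop) (by fun_prop)))

theorem Contract.better_le_max (w : Contract) (p y : ℝ≥0) : w.better p y ≤ max p y := by
  unfold Contract.better
  split_ifs <;> simp

theorem measurable_apply_of_countable {α β ι : Type*} [MeasurableSpace α] [MeasurableSpace β]
    [Countable ι] {N : α → ι} (hN : ∀ i, MeasurableSet {x | N x = i}) {F : ι → α → β}
    (hF : ∀ i, Measurable (F i)) : Measurable fun x => F (N x) x := by
  intro s hs
  have : (fun x => F (N x) x) ⁻¹' s = ⋃ i, {x | N x = i} ∩ F i ⁻¹' s := by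
    ext x; simp
  rw [this]
  exact .iUnion fun i => (hN i).inter (hF i hs)

section Run

variable {n : ℕ} (σ : Strategy n) (w : Contract)

theorem Strategy.run_succ_none (y : Fin (n + 1) → ℝ≥0) (k : ℕ) {S : Finset (Fin (n + 1))} {p : ℝ≥0}
    (h : σ.next S (w.wage p) = none) : σ.run w y (k + 1) S p = (S, p) := by
  simp [Strategy.run, h]

theorem Strategy.run_succ_some (y : Fin (n + 1) → ℝ≥0) (k : ℕ) {S : Finset (Fin (n + 1))} {p : ℝ≥0}
    {i : Fin (n + 1)} (h : σ.next S (w.wage p) = some i) :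
    σ.run w y (k + 1) S p = σ.run w y k (insert i S) (w.better p (y i)) := by
  simp [Strategy.run, h]

/-- Sampled projects are never sampled again, so their prizes are not read later. -/
theorem Strategy.run_congr {y y' : Fin (n + 1) → ℝ≥0} (k : ℕ) {S : Finset (Fin (n + 1))} (p : ℝ≥0)
    (h : ∀ i ∉ S, y i = y' i) : σ.run w y k S p = σ.run w y' k S p := by
  induction k generalizing S p with
  | zero => rfl
  | succ k ih =>
    cases hi : σ.next S (w.wage p) with
    | none => rw [σ.run_succ_none w y k hi, σ.run_succ_none w y' k hi]
    | some i =>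
      rw [σ.run_succ_some w y k hi, σ.run_succ_some w y' k hi, h i (σ.next_notMem _ _ _ hi)]
      exact ih _ fun j hj => h j fun hS => hj (Finset.mem_insert_of_mem hS)

/-- Joint measurability in the starting prize is needed because conditioning on a sampled prize
makes that prize part of the starting state. -/
theorem Strategy.measurable_run {h : Finset (Fin (n + 1)) → ℝ≥0 → ℝ≥0∞} (hh : ∀ S, Measurable (h S))
    (k : ℕ) (S : Finset (Fin (n + 1))) :
    Measurable fun x : ℝ≥0 × (Fin (n + 1) → ℝ≥0) =>
      h (σ.run w x.2 k S x.1).1 (σ.run w x.2 k S x.1).2 := by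
  induction k generalizing S with
  | zero => exact (hh S).comp measurable_fst
  | succ k ih =>
    let F : Option (Fin (n + 1)) → ℝ≥0 × (Fin (n + 1) → ℝ≥0) → ℝ≥0∞
      | none, x => h S x.1
      | some i, x => h (σ.run w x.2 k (insert i S) (w.better x.1 (x.2 i))).1
          (σ.run w x.2 k (insert i S) (w.better x.1 (x.2 i))).2
    have hF : ∀ o, Measurable (F o)
      | none => (hh S).comp measurable_fst
      | some i => (ih (insert i S)).comp
          (f := fun x : ℝ≥0 × (Fin (n + 1) → ℝ≥0) => (w.better x.1 (x.2 i), x.2))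
          ((w.measurable_better_uncurry.comp
            (measurable_fst.prodMk ((measurable_pi_apply i).comp measurable_snd))).prodMk
            measurable_snd)
    convert measurable_apply_of_countable
      (N := fun x : ℝ≥0 × (Fin (n + 1) → ℝ≥0) => σ.next S (w.wage x.1))
      (fun o => (w.measurable_wage.comp measurable_fst) (σ.measurable_next S o)) hF using 2 with x
    cases hi : σ.next S (w.wage x.1) with
    | none => rw [σ.run_succ_none w _ k hi]
    | some i => rw [σ.run_succ_some w _ k hi]

theorem Strategy.run_snd_le (y : Fin (n + 1) → ℝ≥0) (k : ℕ) (S : Finset (Fin (n + 1))) (p : ℝ≥0) :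
    (σ.run w y k S p).2 ≤ max p (∑ i, y i) := by
  induction k generalizing S p with
  | zero => exact le_max_left _ _
  | succ k ih =>
    cases hi : σ.next S (w.wage p) with
    | none => rw [σ.run_succ_none w y k hi]; exact le_max_left _ _
    | some i =>
      rw [σ.run_succ_some w y k hi]
      refine (ih _ _).trans (max_le ((w.better_le_max _ _).trans (max_le_max le_rfl ?_))
        (le_max_right _ _))
      exact Finset.single_le_sum (fun _ _ => zero_le) (Finset.mem_univ i)

/-- The presented prize is at least as good for the agent as every prize in the final set. -/
theorem Strategy.run_best (y : Fin (n + 1) → ℝ≥0) (j : Fin (n + 1)) (k : ℕ)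
    (S : Finset (Fin (n + 1))) (p : ℝ≥0)
    (hS : j ∈ S → w.wage (y j) ≤ w.wage p ∧ (w.wage (y j) = w.wage p → y j ≤ p))
    (hj : j ∈ (σ.run w y k S p).1) :
    w.wage (y j) ≤ w.wage (σ.run w y k S p).2 ∧
      (w.wage (y j) = w.wage (σ.run w y k S p).2 → y j ≤ (σ.run w y k S p).2) := by
  induction k generalizing S p with
  | zero => exact hS hj
  | succ k ih =>
    cases hi : σ.next S (w.wage p) with
    | none =>
      rw [σ.run_succ_none w y k hi] at hj ⊢
      exact hS hj
    | some i =>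
      rw [σ.run_succ_some w y k hi] at hj ⊢
      refine ih _ _ (fun hjS => ?_) hj
      unfold Contract.better
      rcases Finset.mem_insert.1 hjS with rfl | hjS
      · split_ifs with h
        · simp
        · push Not at h
          exact ⟨h.1, fun h' => (h.2 h'.symm).le⟩
      · obtain ⟨h1, h2⟩ := hS hjS
        split_ifs with h
        · rcases h with h | h
          · exact ⟨h1.trans h.le, fun h' => absurd (h1.trans_lt h) h'.not_lt⟩
          · exact ⟨h1.trans h.1.le, fun h' => (h2 (h'.trans h.1.symm)).trans h.2⟩
        · exact ⟨h1, h2⟩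

end Run

/-! ### Conditioning on the prize of one project -/

instance {n : ℕ} (a : Fin (n + 1) → Project) : IsProbabilityMeasure (prizeLaw a) := by
  unfold prizeLaw; infer_instance

theorem measurePreserving_eval_prizeLaw {n : ℕ} (a : Fin (n + 1) → Project) (i : Fin (n + 1)) :
    MeasurePreserving (fun y : Fin (n + 1) → ℝ≥0 => y i) (prizeLaw a) ((a i).law : Measure ℝ≥0) :=
  measurePreserving_eval (fun i => ((a i).law : Measure ℝ≥0)) i

/-- Redrawing one coordinate independently preserves a product law. This replaces disintegration
along coordinate `i`. -/
theorem measurePreserving_update_prizeLaw {n : ℕ} (a : Fin (n + 1) → Project) (i : Fin (n + 1)) :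
    MeasurePreserving (fun x : ℝ≥0 × (Fin (n + 1) → ℝ≥0) => Function.update x.2 i x.1)
      (((a i).law : Measure ℝ≥0).prod (prizeLaw a)) (prizeLaw a) := by
  have hm : Measurable fun x : ℝ≥0 × (Fin (n + 1) → ℝ≥0) => Function.update x.2 i x.1 := by
    refine measurable_pi_lambda _ fun j => ?_
    rcases eq_or_ne j i with rfl | h
    · simpa using measurable_fst
    · simp only [ne_eq, h, not_false_eq_true, Function.update_of_ne]
      fun_prop
  refine ⟨hm, (Measure.pi_eq fun s hs => ?_).symm⟩
  rw [Measure.map_apply hm (.univ_pi hs)]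
  have : (fun x : ℝ≥0 × (Fin (n + 1) → ℝ≥0) => Function.update x.2 i x.1) ⁻¹' univ.pi s =
      s i ×ˢ univ.pi (Function.update s i univ) := by
    ext ⟨t, y⟩
    simp only [mem_preimage, mem_univ_pi, mem_prod]
    refine ⟨fun h => ⟨by simpa using h i, fun j => ?_⟩, fun h j => ?_⟩
    · rcases eq_or_ne j i with rfl | hj
      · simp
      · simpa [hj] using h j
    · rcases eq_or_ne j i with rfl | hj
      · simpa using h.1
      · simpa [hj] using h.2 j
  rw [this, Measure.prod_prod, prizeLaw, Measure.pi_pi, ← Finset.mul_prod_erase _ _ (Finset.mem_univ i),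
    ← Finset.mul_prod_erase _ (fun j => ((a j).law : Measure ℝ≥0) (s j)) (Finset.mem_univ i)]
  simp only [Function.update_self, measure_univ, one_mul]
  congr 1
  refine Finset.prod_congr rfl fun j hj => ?_
  rw [Function.update_of_ne (Finset.ne_of_mem_erase hj)]

/-- Redraw coordinate `i` and apply Tonelli; the continuation ignores the redrawn coordinate by
`Strategy.run_congr`. -/
theorem lintegral_run_succ_some {n : ℕ} (a : Fin (n + 1) → Project) (σ : Strategy n) (w : Contract)
    {h : Finset (Fin (n + 1)) → ℝ≥0 → ℝ≥0∞} (hh : ∀ S, Measurable (h S)) (k : ℕ)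
    {S : Finset (Fin (n + 1))} {p : ℝ≥0} {i : Fin (n + 1)} (hi : σ.next S (w.wage p) = some i) :
    ∫⁻ y, h (σ.run w y (k + 1) S p).1 (σ.run w y (k + 1) S p).2 ∂prizeLaw a =
      ∫⁻ t, ∫⁻ y, h (σ.run w y k (insert i S) (w.better p t)).1
        (σ.run w y k (insert i S) (w.better p t)).2 ∂prizeLaw a ∂((a i).law : Measure ℝ≥0) := by
  simp only [σ.run_succ_some w _ k hi]
  have hm := σ.measurable_run w hh k (insert i S)
  have hb := w.measurable_better p
  have hm' : Measurable fun y : Fin (n + 1) → ℝ≥0 =>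
      h (σ.run w y k (insert i S) (w.better p (y i))).1
        (σ.run w y k (insert i S) (w.better p (y i))).2 :=
    hm.comp (f := fun y : Fin (n + 1) → ℝ≥0 => (w.better p (y i), y)) (by fun_prop)
  rw [← (measurePreserving_update_prizeLaw a i).lintegral_comp hm', lintegral_prod _ ?_]
  · refine lintegral_congr fun t => lintegral_congr fun y => ?_
    rw [Function.update_self, σ.run_congr w (y := Function.update y i t) (y' := y)]
    intro j hj
    exact Function.update_of_ne (ne_of_mem_of_not_mem (Finset.mem_insert_self i S) hj).symm _ _
  · exact (hm'.comp (measurePreserving_update_prizeLaw a i).measurable).aemeasurable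

/-! ### The agent's value function -/

section Value

variable {n : ℕ} (w : Contract) (a : Fin (n + 1) → Project)

/-- The agent's value with at most `k` further samples, when the projects in `S` have been sampled
and the highest wage so far is `v`. -/
def fuelValue : ℕ → Finset (Fin (n + 1)) → ℝ≥0 → ℝ≥0∞
  | 0, _, v => v
  -- Truncated subtraction is harmless: a negative net value never beats stopping with `v ≥ 0`.
  | k + 1, S, v => v ⊔ Sᶜ.sup fun i =>
      (∫⁻ t, fuelValue k (insert i S) (max v (w.wage t)) ∂((a i).law : Measure ℝ≥0)) - (a i).cost

/-- The agent's value, gross of the costs incurred so far, when the projects in `S` have been sampled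
and the highest wage so far is `v`. -/
def value (S : Finset (Fin (n + 1))) : ℝ≥0 → ℝ≥0∞ := fuelValue w a Sᶜ.card S

/-- The agent's value, gross of the cost of `i`, of sampling `i` and continuing optimally. -/
def contValue (S : Finset (Fin (n + 1))) (i : Fin (n + 1)) (v : ℝ≥0) : ℝ≥0∞ :=
  ∫⁻ t, value w a (insert i S) (max v (w.wage t)) ∂((a i).law : Measure ℝ≥0)

/-- The Bellman equation: the fuel counts the unsampled projects, so each sample uses up exactly one
unit. -/
theorem value_eq (S : Finset (Fin (n + 1))) (v : ℝ≥0) :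
    value w a S v = (v : ℝ≥0∞) ⊔ Sᶜ.sup fun i => contValue w a S i v - (a i).cost := by
  rcases hk : Sᶜ.card with _ | k
  · simp [value, fuelValue, Finset.card_eq_zero.1 hk]
  · rw [value, hk, fuelValue]
    congr 1
    refine Finset.sup_congr rfl fun i hi => ?_
    have : (insert i S)ᶜ.card = k := by
      rw [Finset.compl_insert, Finset.card_erase_of_mem hi, hk, Nat.add_sub_cancel]
    simp only [contValue, value, this]

theorem measurable_fuelValue (k : ℕ) (S : Finset (Fin (n + 1))) : Measurable (fuelValue w a k S) := by
  induction k generalizing S with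
  | zero => exact measurable_coe_nnreal_ennreal
  | succ k ih =>
    have hw := w.measurable_wage
    have hsup : ∀ (T : Finset (Fin (n + 1))) (f : Fin (n + 1) → ℝ≥0 → ℝ≥0∞),
        (∀ i, Measurable (f i)) → Measurable fun v => T.sup fun i => f i v := fun T f hf => by
      simp only [Finset.sup_eq_iSup]
      exact .biSup _ (to_countable _) fun i _ => hf i
    refine measurable_coe_nnreal_ennreal.sup (hsup _ _ fun i => Measurable.sub_const ?_ _)
    exact Measurable.lintegral_prod_right'
      (f := fun x : ℝ≥0 × ℝ≥0 => fuelValue w a k (insert i S) (max x.1 (w.wage x.2)))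
      ((ih _).comp (by fun_prop))

theorem measurable_value (S : Finset (Fin (n + 1))) : Measurable (value w a S) :=
  measurable_fuelValue w a _ S

theorem measurable_contValue (S : Finset (Fin (n + 1))) (i : Fin (n + 1)) :
    Measurable (contValue w a S i) := by
  have hw := w.measurable_wage
  exact Measurable.lintegral_prod_right'
    (f := fun x : ℝ≥0 × ℝ≥0 => value w a (insert i S) (max x.1 (w.wage x.2)))
    ((measurable_value w a _).comp (by fun_prop))

theorem le_value (S : Finset (Fin (n + 1))) (v : ℝ≥0) : (v : ℝ≥0∞) ≤ value w a S v := by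
  rw [value_eq]; exact le_sup_left

theorem contValue_le {S : Finset (Fin (n + 1))} {i : Fin (n + 1)} (hi : i ∉ S) (v : ℝ≥0) :
    contValue w a S i v ≤ value w a S v + (a i).cost := by
  rw [← tsub_le_iff_right, value_eq]
  exact le_sup_of_le_right
    (Finset.le_sup (f := fun i => contValue w a S i v - (a i).cost) (Finset.mem_compl.2 hi))

theorem lintegral_wage_le_contValue (S : Finset (Fin (n + 1))) (i : Fin (n + 1)) (v : ℝ≥0) :
    ∫⁻ t, w.wage t ∂((a i).law : Measure ℝ≥0) ≤ contValue w a S i v :=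
  lintegral_mono fun _ => (ENNReal.coe_le_coe.2 (le_max_right v _)).trans (le_value w a _ _)

theorem value_eq_self {S : Finset (Fin (n + 1))} {v : ℝ≥0}
    (h : ∀ i ∉ S, contValue w a S i v < value w a S v + (a i).cost) : value w a S v = v := by
  refine le_antisymm ?_ (le_value w a S v)
  by_contra! hv
  refine (value_eq w a S v).not_gt (max_lt hv ?_)
  refine (Finset.sup_lt_iff (bot_le.trans_lt hv)).2 fun i hi => ?_
  have h' := h i (Finset.mem_compl.1 hi)
  rcases le_total (contValue w a S i v) (a i).cost with hc | hc
  · rw [tsub_eq_zero_of_le hc]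
    exact zero_le.trans_lt hv
  · exact ENNReal.sub_lt_of_lt_add hc h'

/-- The total cost of the projects in `S`. -/
def totalCost (S : Finset (Fin (n + 1))) : ℝ≥0∞ := ∑ i ∈ S, ((a i).cost : ℝ≥0∞)

theorem totalCost_ne_top (S : Finset (Fin (n + 1))) : totalCost a S ≠ ⊤ :=
  ENNReal.sum_ne_top.2 fun _ _ => ENNReal.coe_ne_top

theorem totalCost_insert {S : Finset (Fin (n + 1))} {i : Fin (n + 1)} (hi : i ∉ S) :
    totalCost a (insert i S) = (a i).cost + totalCost a S :=
  Finset.sum_insert hi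

/-- No strategy beats the value function. Costs are added rather than subtracted, since the expected
wage may be infinite; `totalCost a S` offsets the sunk costs included in the final total. -/
theorem lintegral_wage_run_le (τ : Strategy n) (k : ℕ) (S : Finset (Fin (n + 1))) (p : ℝ≥0) :
    ∫⁻ y, (w.wage (τ.run w y k S p).2 : ℝ≥0∞) ∂prizeLaw a + totalCost a S ≤
      value w a S (w.wage p) + ∫⁻ y, totalCost a (τ.run w y k S p).1 ∂prizeLaw a := by
  induction k generalizing S p with
  | zero => simpa [Strategy.run] using add_le_add_left (le_value w a S (w.wage p)) _
  | succ k ih =>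
    cases hi : τ.next S (w.wage p) with
    | none =>
      simpa [τ.run_succ_none w _ k hi] using add_le_add_left (le_value w a S (w.wage p)) _
    | some i =>
      have hiS := τ.next_notMem _ _ _ hi
      have hw := w.measurable_wage
      rw [lintegral_run_succ_some a τ w (h := fun _ p => (w.wage p : ℝ≥0∞)) (by fun_prop) k hi,
        lintegral_run_succ_some a τ w (h := fun S _ => totalCost a S) (by fun_prop) k hi,
        ← ENNReal.add_le_add_iff_left (ENNReal.coe_ne_top (r := (a i).cost)), add_left_comm,
        ← totalCost_insert a hiS]
      calc _ = ∫⁻ t, (∫⁻ y, (w.wage (τ.run w y k (insert i S) (w.better p t)).2 : ℝ≥0∞) ∂prizeLaw a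
              + totalCost a (insert i S)) ∂((a i).law : Measure ℝ≥0) := by
            rw [lintegral_add_right _ measurable_const]; simp
        _ ≤ ∫⁻ t, (value w a (insert i S) (max (w.wage p) (w.wage t)) +
              ∫⁻ y, totalCost a (τ.run w y k (insert i S) (w.better p t)).1 ∂prizeLaw a)
                ∂((a i).law : Measure ℝ≥0) :=
            lintegral_mono fun t => (ih _ _).trans_eq (by rw [w.wage_better])
        _ = contValue w a S i (w.wage p) + _ :=
            lintegral_add_left ((measurable_value w a _).comp (by fun_prop)) _
        _ ≤ _ := by
            rw [← add_assoc, add_comm ((a i).cost : ℝ≥0∞)]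
            gcongr
            exact contValue_le w a hiS _

/-! ### A greedy strategy -/

/-- The projects whose sampling is optimal. -/
def bestProjects (S : Finset (Fin (n + 1))) (v : ℝ≥0) : Finset (Fin (n + 1)) :=
  open Classical in {i | i ∉ S ∧ value w a S v + (a i).cost ≤ contValue w a S i v}

theorem mem_bestProjects {S : Finset (Fin (n + 1))} {v : ℝ≥0} {i : Fin (n + 1)} :
    i ∈ bestProjects w a S v ↔ i ∉ S ∧ value w a S v + (a i).cost ≤ contValue w a S i v := by
  simp [bestProjects]

theorem measurableSet_bestProjects_eq (S T : Finset (Fin (n + 1))) :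
    MeasurableSet {v | bestProjects w a S v = T} := by
  simp only [Finset.ext_iff, mem_bestProjects, ofPred_forall]
  refine .iInter fun i => .iff (MeasurableSet.inter (.const (i ∉ S)) ?_) (.const (i ∈ T))
  exact measurableSet_le ((measurable_value w a S).add_const _) (measurable_contValue w a S i)

/-- The strategy that samples a project whenever this is optimal, even if stopping is as good. -/
def greedyStrategy : Strategy n where
  next S v := if h : (bestProjects w a S v).Nonempty then some ((bestProjects w a S v).min' h) else none
  next_notMem S v i h := by
    split_ifs at h with hne
    cases h
    exact ((mem_bestProjects w a).1 (Finset.min'_mem _ hne)).1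
  measurable_next S o := by
    have : {v | (if h : (bestProjects w a S v).Nonempty then
        some ((bestProjects w a S v).min' h) else none) = o} =
        ⋃ T ∈ {T : Finset (Fin (n + 1)) | (if h : T.Nonempty then some (T.min' h) else none) = o},
          {v | bestProjects w a S v = T} := by
      ext v; simp
    rw [this]
    exact .biUnion (to_countable _) fun T _ => measurableSet_bestProjects_eq w a S T

variable {w a}

theorem greedyStrategy_next_some {S : Finset (Fin (n + 1))} {v : ℝ≥0} {i : Fin (n + 1)}
    (h : (greedyStrategy w a).next S v = some i) :
    contValue w a S i v = value w a S v + (a i).cost := by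
  have hS := (greedyStrategy w a).next_notMem _ _ _ h
  simp only [greedyStrategy] at h
  split_ifs at h with hne
  cases h
  exact (contValue_le w a hS v).antisymm ((mem_bestProjects w a).1 (Finset.min'_mem _ hne)).2

theorem greedyStrategy_next_none {S : Finset (Fin (n + 1))} {v : ℝ≥0}
    (h : (greedyStrategy w a).next S v = none) {i : Fin (n + 1)} (hi : i ∉ S) :
    contValue w a S i v < value w a S v + (a i).cost := by
  simp only [greedyStrategy] at h
  split_ifs at h with hne
  by_contra! hc
  exact hne ⟨i, (mem_bestProjects w a).2 ⟨hi, hc⟩⟩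

variable (w a)

/-- The same induction with equalities: each greedy step attains the Bellman maximum, and `hk`
ensures that the fuel lasts until every project is sampled. -/
theorem lintegral_wage_greedyStrategy (k : ℕ) (S : Finset (Fin (n + 1))) (hk : Sᶜ.card = k) (p : ℝ≥0) :
    ∫⁻ y, (w.wage ((greedyStrategy w a).run w y k S p).2 : ℝ≥0∞) ∂prizeLaw a + totalCost a S =
      value w a S (w.wage p) +
        ∫⁻ y, totalCost a ((greedyStrategy w a).run w y k S p).1 ∂prizeLaw a := by
  induction k generalizing S p with
  | zero =>
    have : value w a S (w.wage p) = w.wage p := value_eq_self w a fun i hi =>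
      absurd (Finset.mem_compl.2 hi) (by simp [Finset.card_eq_zero.1 hk])
    simp [Strategy.run, this]
  | succ k ih =>
    cases hi : (greedyStrategy w a).next S (w.wage p) with
    | none =>
      simp [Strategy.run_succ_none _ w _ k hi,
        value_eq_self w a fun i hiS => greedyStrategy_next_none hi hiS]
    | some i =>
      have hiS := (greedyStrategy w a).next_notMem _ _ _ hi
      have hw := w.measurable_wage
      have hk' : (insert i S)ᶜ.card = k := by
        rw [Finset.compl_insert, Finset.card_erase_of_mem (Finset.mem_compl.2 hiS), hk,
          Nat.add_sub_cancel]
      rw [lintegral_run_succ_some a _ w (h := fun _ p => (w.wage p : ℝ≥0∞)) (by fun_prop) k hi,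
        lintegral_run_succ_some a _ w (h := fun S _ => totalCost a S) (by fun_prop) k hi,
        ← ENNReal.add_right_inj (ENNReal.coe_ne_top (r := (a i).cost)), add_left_comm,
        ← totalCost_insert a hiS]
      calc _ = ∫⁻ t, (∫⁻ y, (w.wage ((greedyStrategy w a).run w y k (insert i S)
                (w.better p t)).2 : ℝ≥0∞) ∂prizeLaw a
              + totalCost a (insert i S)) ∂((a i).law : Measure ℝ≥0) := by
            rw [lintegral_add_right _ measurable_const]; simp
        _ = ∫⁻ t, (value w a (insert i S) (max (w.wage p) (w.wage t)) +
              ∫⁻ y, totalCost a ((greedyStrategy w a).run w y k (insert i S)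
                (w.better p t)).1 ∂prizeLaw a) ∂((a i).law : Measure ℝ≥0) :=
            lintegral_congr fun t => by rw [ih _ hk', w.wage_better]
        _ = contValue w a S i (w.wage p) + _ :=
            lintegral_add_left ((measurable_value w a _).comp (by fun_prop)) _
        _ = _ := by
            rw [← add_assoc, add_comm ((a i).cost : ℝ≥0∞), greedyStrategy_next_some hi]

theorem lintegral_cost_ne_top (σ : Strategy n) :
    ∫⁻ y, totalCost a (σ.outcome w y).1 ∂prizeLaw a ≠ ⊤ := by
  refine ne_top_of_le_ne_top (totalCost_ne_top a Finset.univ) ?_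
  calc _ ≤ ∫⁻ _, totalCost a Finset.univ ∂prizeLaw a :=
        lintegral_mono fun y => Finset.sum_le_sum_of_subset (Finset.subset_univ _)
    _ = _ := by simp

theorem greedyStrategy_mem_optimalStrategies : greedyStrategy w a ∈ optimalStrategies w a := by
  intro τ
  have h0 : totalCost a ∅ = 0 := Finset.sum_empty
  have h1 := lintegral_wage_run_le w a τ (n + 1) ∅ 0
  have h2 := lintegral_wage_greedyStrategy w a (n + 1) ∅ (by simp) 0
  rw [h0, add_zero] at h1 h2
  -- A finite cost cancels in `EReal` even when the value is infinite.
  have key : ∀ C : ℝ≥0∞, C ≠ ⊤ → ∀ V : ℝ≥0∞, ((V + C : ℝ≥0∞) : EReal) - C = V := fun C hC V => by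
    lift C to ℝ≥0 using hC
    rw [EReal.coe_ennreal_add]
    exact EReal.add_sub_cancel_right (b := (C : ℝ))
  calc agentPayoff w a τ ≤ ((value w a ∅ (w.wage 0) : ℝ≥0∞) : EReal) := by
        rw [← key _ (lintegral_cost_ne_top w a τ) (value w a ∅ (w.wage 0))]
        exact EReal.sub_le_sub (EReal.coe_ennreal_le_coe_ennreal_iff.2 h1) le_rfl
    _ = agentPayoff w a (greedyStrategy w a) := by
        rw [← key _ (lintegral_cost_ne_top w a (greedyStrategy w a)) (value w a ∅ (w.wage 0))]
        unfold agentPayoff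
        exact congrArg (fun x : ℝ≥0∞ => (x : EReal) - _) h2.symm

/-- If the wage pays for sampling `j`, then the greedy strategy does not stop with a zero wage before
`j` is sampled. -/
theorem greedyStrategy_run_pos {j : Fin (n + 1)}
    (hj : ((a j).cost : ℝ≥0∞) ≤ ∫⁻ t, w.wage t ∂((a j).law : Measure ℝ≥0))
    (y : Fin (n + 1) → ℝ≥0) (k : ℕ) (S : Finset (Fin (n + 1))) (hk : Sᶜ.card = k) (p : ℝ≥0) :
    0 < w.wage ((greedyStrategy w a).run w y k S p).2 ∨
      j ∈ ((greedyStrategy w a).run w y k S p).1 := by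
  induction k generalizing S p with
  | zero =>
    right
    have : S = Finset.univ := by simpa using hk
    simp [Strategy.run, this]
  | succ k ih =>
    cases hi : (greedyStrategy w a).next S (w.wage p) with
    | none =>
      rw [Strategy.run_succ_none _ w _ k hi]
      -- Stopping here would make the value 0 and sampling `j` strictly worse, contradicting `hj`.
      -- Ties must favour sampling, as the debt contract makes `hj` an equality for `a₀`.
      by_contra! h
      have h1 := greedyStrategy_next_none hi h.2
      rw [value_eq_self w a fun i hiS => greedyStrategy_next_none hi hiS,
        nonpos_iff_eq_zero.1 h.1, ENNReal.coe_zero, zero_add] at h1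
      exact (hj.trans (lintegral_wage_le_contValue w a S j 0)).not_gt h1
    | some i =>
      rw [Strategy.run_succ_some _ w _ k hi]
      refine ih _ ?_ _
      rw [Finset.compl_insert, Finset.card_erase_of_mem
        (Finset.mem_compl.2 ((greedyStrategy w a).next_notMem _ _ _ hi)), hk, Nat.add_sub_cancel]

theorem lintegral_outcome_ne_top (σ : Strategy n) :
    ∫⁻ y, ((σ.outcome w y).2 : ℝ≥0∞) ∂prizeLaw a ≠ ⊤ := by
  have h : ∀ y, ((σ.outcome w y).2 : ℝ≥0∞) ≤ ∑ i, (y i : ℝ≥0∞) := fun y => by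
    have := σ.run_snd_le w y (n + 1) ∅ 0
    rw [max_eq_right zero_le] at this
    rw [← ENNReal.ofNNReal_finsetSum]
    exact ENNReal.coe_le_coe.2 this
  refine ne_top_of_le_ne_top ?_ (lintegral_mono h)
  rw [lintegral_finsetSum _ fun i _ => by fun_prop]
  refine ENNReal.sum_ne_top.2 fun i _ => ?_
  rw [(measurePreserving_eval_prizeLaw a i).lintegral_comp measurable_coe_nnreal_ennreal]
  exact (a i).finite_mean

end Value

/-! ### The payoff guarantee -/

theorem surplus_le_principalValue {n : ℕ} (a : Fin (n + 1) → Project) (h0 : 0 ≤ (a 0).index) :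
    (((a 0).surplus : ℝ) : EReal) ≤ principalValue (debtContract (a 0).index) a := by
  set w := debtContract (a 0).index
  set σ := greedyStrategy w a
  have hmw := w.measurable_wage
  have hle : ∀ y, w.wage y ≤ y := wage_debtContract_le h0
  have hcost : ((a 0).cost : ℝ≥0∞) = ∫⁻ t, w.wage t ∂((a 0).law : Measure ℝ≥0) := by
    rw [(a 0).cost_eq_lintegral_excess_index]
    exact lintegral_congr fun t => (coe_wage_debtContract h0 t).symm
  have hpath : ∀ y, y 0 - w.wage (y 0) ≤ (σ.outcome w y).2 - w.wage (σ.outcome w y).2 := fun y =>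
    sub_wage_debtContract_le h0
      ((greedyStrategy_run_pos w a hcost.le y (n + 1) ∅ (by simp) 0).imp_right
        (σ.run_best w y 0 (n + 1) ∅ 0 (by simp)))
  have hsplit : ∀ y : ℝ≥0, (y : ℝ≥0∞) = ((y - w.wage y : ℝ≥0) : ℝ≥0∞) + w.wage y := fun y => by
    rw [← ENNReal.coe_add, tsub_add_cancel_of_le (hle y)]
  -- By `hcost`, the mean prize s₀ + c₀ splits into the mean share and a mean wage of c₀.
  have hshare : ∫⁻ y, ((y - w.wage y : ℝ≥0) : ℝ≥0∞) ∂((a 0).law : Measure ℝ≥0) =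
      ENNReal.ofReal (a 0).surplus := by
    refine (ENNReal.add_left_inj (ENNReal.coe_ne_top (r := (a 0).cost))).1 ?_
    rw [← Project.lintegral_prize (Project.surplus_nonneg h0), hcost,
      ← lintegral_add_right _ (by fun_prop)]
    exact lintegral_congr fun y => (hsplit y).symm
  have hfin : ∫⁻ y, (w.wage (σ.outcome w y).2 : ℝ≥0∞) ∂prizeLaw a ≠ ⊤ :=
    ne_top_of_le_ne_top (lintegral_outcome_ne_top w a σ)
      (lintegral_mono fun y => ENNReal.coe_le_coe.2 (hle _))
  have hmain : ENNReal.ofReal (a 0).surplus + ∫⁻ y, (w.wage (σ.outcome w y).2 : ℝ≥0∞) ∂prizeLaw a ≤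
      ∫⁻ y, ((σ.outcome w y).2 : ℝ≥0∞) ∂prizeLaw a := by
    rw [← hshare, ← (measurePreserving_eval_prizeLaw a 0).lintegral_comp (by fun_prop),
      ← lintegral_add_left (by fun_prop)]
    refine lintegral_mono fun y => ?_
    rw [hsplit (σ.outcome w y).2]
    exact add_le_add_left (ENNReal.coe_le_coe.2 (hpath y)) _
  refine le_trans ?_ (le_iSup₂_of_le σ (greedyStrategy_mem_optimalStrategies w a) le_rfl)
  unfold principalPayoff
  generalize ∫⁻ y, (w.wage (σ.outcome w y).2 : ℝ≥0∞) ∂prizeLaw a = W at *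
  generalize ∫⁻ y, ((σ.outcome w y).2 : ℝ≥0∞) ∂prizeLaw a = Y at *
  rw [EReal.le_sub_iff_add_le (.inl (by simp)) (.inl (by simpa using hfin))]
  calc _ = ((ENNReal.ofReal (a 0).surplus + W : ℝ≥0∞) : EReal) := by
        rw [EReal.coe_ennreal_add, EReal.coe_ennreal_ofReal,
          max_eq_left (Project.surplus_nonneg h0)]
    _ ≤ _ := EReal.coe_ennreal_le_coe_ennreal_iff.2 hmain

/-- The strategy that stops at once. -/
def stopStrategy (n : ℕ) : Strategy n where
  next _ _ := none
  next_notMem _ _ _ h := by cases h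
  measurable_next _ _ := .const _

theorem principalValue_singleton_le {a₀ : Project} (h : 0 ≤ a₀.surplus) (w : Contract) :
    principalValue w (fun _ : Fin (0 + 1) => a₀) ≤ ((a₀.surplus : ℝ) : EReal) := by
  set a : Fin (0 + 1) → Project := fun _ => a₀
  refine iSup₂_le fun σ hσ => ?_
  have hC := lintegral_cost_ne_top w a σ
  have hsum : ∫⁻ y, ((σ.outcome w y).2 : ℝ≥0∞) ∂prizeLaw a ≤
      ENNReal.ofReal a₀.surplus + ∫⁻ y, totalCost a (σ.outcome w y).1 ∂prizeLaw a := by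
    -- The first decision is deterministic, and with one project it is the only one.
    cases hi : σ.next ∅ (w.wage 0) with
    | none => simp [Strategy.outcome, σ.run_succ_none w _ 0 hi]
    | some i =>
      have : ∀ y, ((σ.outcome w y).2 : ℝ≥0∞) ≤ y i := fun y => by
        rw [Strategy.outcome, σ.run_succ_some w _ 0 hi]
        exact ENNReal.coe_le_coe.2 ((w.better_le_max _ _).trans (by simp))
      refine (lintegral_mono this).trans ?_
      rw [(measurePreserving_eval_prizeLaw a i).lintegral_comp measurable_coe_nnreal_ennreal,
        Project.lintegral_prize h]
      have hcost : ∀ y, totalCost a (σ.outcome w y).1 = a₀.cost := fun y => by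
        rw [Strategy.outcome, σ.run_succ_some w _ 0 hi]
        simp [Strategy.run, totalCost, a]
      simp [hcost]
  have hopt : ∫⁻ y, totalCost a (σ.outcome w y).1 ∂prizeLaw a ≤
      ∫⁻ y, (w.wage (σ.outcome w y).2 : ℝ≥0∞) ∂prizeLaw a := by
    have h0 : 0 ≤ agentPayoff w a σ := by
      refine le_trans ?_ (hσ (stopStrategy 0))
      simp [agentPayoff, Strategy.outcome, Strategy.run, stopStrategy, EReal.coe_ennreal_nonneg]
    rw [agentPayoff, EReal.sub_nonneg (.inr (by simpa [totalCost] using hC)) (.inr (by simp))] at h0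
    exact EReal.coe_ennreal_le_coe_ennreal_iff.1 h0
  unfold principalPayoff
  refine EReal.sub_le_of_le_add ?_
  calc _ ≤ ((ENNReal.ofReal a₀.surplus +
        ∫⁻ y, (w.wage (σ.outcome w y).2 : ℝ≥0∞) ∂prizeLaw a : ℝ≥0∞) : EReal) :=
        EReal.coe_ennreal_le_coe_ennreal_iff.2 (hsum.trans (by gcongr))
    _ = _ := by rw [EReal.coe_ennreal_add, EReal.coe_ennreal_ofReal, max_eq_left h]

theorem payoffGuarantee_le {a₀ : Project} (h : 0 ≤ a₀.surplus) (w : Contract) :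
    payoffGuarantee a₀ w ≤ ((a₀.surplus : ℝ) : EReal) :=
  iInf_le_of_le 0 <| iInf₂_le_of_le (fun _ => a₀) rfl (principalValue_singleton_le h w)

theorem payoffGuarantee_debtContract {a₀ : Project} (h : 0 ≤ a₀.index) :
    payoffGuarantee a₀ (debtContract a₀.index) = ((a₀.surplus : ℝ) : EReal) := by
  refine (payoffGuarantee_le (Project.surplus_nonneg h) _).antisymm ?_
  refine le_iInf fun n => le_iInf₂ fun a ha => ?_
  subst ha
  exact surplus_le_principalValue a h

theorem maxGuarantee_eq {a₀ : Project} (h : 0 ≤ a₀.index) :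
    maxGuarantee a₀ = ((a₀.surplus : ℝ) : EReal) :=
  (iSup_le (payoffGuarantee_le (Project.surplus_nonneg h))).antisymm
    ((payoffGuarantee_debtContract h).symm.trans_le (le_iSup (payoffGuarantee a₀) _))

end DelegatedSearch

end

theorem proposition1 (a₀ : DelegatedSearch.Project) (hr₀ : 0 ≤ a₀.index) :
    DelegatedSearch.payoffGuarantee a₀ (DelegatedSearch.debtContract a₀.index)
        = ((a₀.surplus : ℝ) : EReal) ∧
      DelegatedSearch.RobustlyOptimal a₀ (DelegatedSearch.debtContract a₀.index) ∧
      DelegatedSearch.maxGuarantee a₀ = ((a₀.surplus : ℝ) : EReal) :=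
  have h := DelegatedSearch.payoffGuarantee_debtContract hr₀
  have h' := DelegatedSearch.maxGuarantee_eq hr₀
  ⟨h, h.trans h'.symm, h'⟩
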